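/- Let $m\ge 1$, let $A\subseteq\mathbb R^m$ be a convex compact set, let $f:\mathbb R^m\to\mathbb R$ be Lipschitz on $A$, and let $\lambda\ge 0$. For a finite set $P\subseteq\mathbb R^m$ and $p\in P$ let $C(p)=\{x\in\mathbb R^m : d(x,p)\le d(x,q)\ \forall q\in P\}$ be the Voronoi cell of $p$. Let $\mathrm{Del}_P$ be the set of $m$-dimensional simplices $\sigma=\langle v_0,\dots,v_m\rangle$ (affinely independent vertices) with $v_i\in P$ and $\bigcap_i C(v_i)\ne\emptyset$. The lifting of $\sigma$ is the simplex $\hat\sigma=\langle (v_0,\lambda f(v_0)),\dots,(v_m,\lambda f(v_m))\rangle$ in $\mathbb R^{m+1}$, and $\mathrm{Vol}(\hat\sigma)$ is its $m$-dimensional volume, given by the Cayley–Menger formula $$\mathrm{Vol}(\langle w_0,\dots,w_k\rangle)=\sqrt{\frac{(-1)^{k+1}}{2^k(k!)^2}\det M},$$ where $M$ is the matrix $(d(w_i,w_j)^2)_{i,j}$ padded by a top row and a left column equal to $(0,1,\dots,1)$. Let $P_0\subseteq A$ be finite, and let $P_0,P_1,P_2,\dots$ be produced by the following iteration. At step $t$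 choose $\overline\sigma\in\mathrm{Del}_{P_t}$ for which $\mathrm{Vol}(\hat{\overline\sigma})$ is the largest (ties are broken arbitrarily), and set $P_{t+1}=P_t\cup\{p_{t+1}\}$, where $p_{t+1}$ is the circumcenter of $\overline\sigma$ if it lies in $A$, and otherwise the point where the segment from the barycenter to the circumcenter of $\overline\sigma$ meets $\partial A$. (If $\mathrm{Del}_{P_t}$ is empty, set $P_{t+1}=P_t$.) Let $s_t=\max_{\sigma\in\mathrm{Del}_{P_t}}\mathrm{Vol}(\hat\sigma)$, with $s_t=0$ if $\mathrm{Del}_{P_t}$ is empty. Then $$\liminf_{t\to\infty}s_t=0.$$ In particular, for every $\varepsilon>0$ there is a $t$ with $s_t<\varepsilon$, that is, the ANNR (Active Nearest Neighbor Regression) algorithm, which runs this iteration as long as $s_t\ge\varepsilon$, halts. -/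

import Mathlib

namespace ANNR

/-- The closed Voronoi cell of `p` with respect to the finite set of datapoints `P` in `ℝᵐ`. -/
def voronoiCell {m : ℕ} (P : Finset (EuclideanSpace ℝ (Fin m))) (p : EuclideanSpace ℝ (Fin m)) :
    Set (EuclideanSpace ℝ (Fin m)) :=
  {x | ∀ q ∈ P, dist x p ≤ dist x q}

/-- The `k`-dimensional simplices (with affinely independent vertices) of the Delaunay
triangulation generated by `P`: the vertices are in `P` and their Voronoi cells have a common
point. Simplices carry an ordering of their vertices, which plays no role below. -/
def delaunay {m : ℕ} (P : Finset (EuclideanSpace ℝ (Fin m))) (k : ℕ) :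
    Set (Affine.Simplex ℝ (EuclideanSpace ℝ (Fin m)) k) :=
  {σ | (∀ i, σ.points i ∈ P) ∧ (⋂ i, voronoiCell P (σ.points i)).Nonempty}

/-- The matrix of squared mutual distances of `v₀, …, v_k`, padded by a top row and a left column
equal to `(0, 1, …, 1)`. -/
noncomputable def cayleyMengerMatrix {X : Type*} [MetricSpace X] {k : ℕ} (v : Fin (k + 1) → X) :
    Matrix (Unit ⊕ Fin (k + 1)) (Unit ⊕ Fin (k + 1)) ℝ :=
  Matrix.fromBlocks (Matrix.of fun _ _ => 0) (Matrix.of fun _ _ => 1)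
    (Matrix.of fun _ _ => 1) (Matrix.of fun i j => dist (v i) (v j) ^ 2)

/-- The `k`-dimensional volume of the simplex `⟨v₀, …, v_k⟩`, by the Cayley-Menger formula. -/
noncomputable def simplexVol {X : Type*} [MetricSpace X] {k : ℕ} (v : Fin (k + 1) → X) : ℝ :=
  Real.sqrt ((-1) ^ (k + 1) / (2 ^ k * (k.factorial : ℝ) ^ 2) * (cayleyMengerMatrix v).det)

/-- The point `(x, lam * f x)` of `ℝᵐ⁺¹` on the graph of `lam * f`. -/
noncomputable def graphPoint {m : ℕ} (lam : ℝ) (f : EuclideanSpace ℝ (Fin m) → ℝ)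
    (x : EuclideanSpace ℝ (Fin m)) : EuclideanSpace ℝ (Fin (m + 1)) :=
  WithLp.toLp 2 (Fin.snoc (α := fun _ => ℝ) (fun i => x i) (lam * f x))

/-- The volume of the lifting of the `m`-simplex `σ` to the graph of `lam * f`. -/
noncomputable def liftVol {m : ℕ} (lam : ℝ) (f : EuclideanSpace ℝ (Fin m) → ℝ)
    (σ : Affine.Simplex ℝ (EuclideanSpace ℝ (Fin m)) m) : ℝ :=
  simplexVol fun i => graphPoint lam f (σ.points i)

/-- The largest volume of the lifting of an `m`-simplex of the Delaunay triangulation of `P`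
(a maximum over a finite set; it is `0` if there is no `m`-simplex). -/
noncomputable def maxLiftVol {m : ℕ} (lam : ℝ) (f : EuclideanSpace ℝ (Fin m) → ℝ)
    (P : Finset (EuclideanSpace ℝ (Fin m))) : ℝ :=
  sSup (liftVol lam f '' delaunay P m)

/-- `p` is the point queried for the simplex `σ`, with bounding region `A`: the circumcenter of
`σ` if it is in `A`, and otherwise the intersection of the boundary of `A` with the segment from
the barycenter to the circumcenter. -/
def IsQuery {m : ℕ} (A : Set (EuclideanSpace ℝ (Fin m)))
    (σ : Affine.Simplex ℝ (EuclideanSpace ℝ (Fin m)) m) (p : EuclideanSpace ℝ (Fin m)) : Prop :=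
  (σ.circumcenter ∈ A ∧ p = σ.circumcenter) ∨
    (σ.circumcenter ∉ A ∧ p ∈ frontier A ∩ segment ℝ σ.centroid σ.circumcenter)

/-- One iteration of the algorithm turns the dataset `P` into `P'`: the query of an `m`-simplex of
the Delaunay triangulation whose lifting has the largest volume (ties are broken arbitrarily) is
added to `P`. If there is no `m`-simplex, then nothing is queried. -/
def Step {m : ℕ} (A : Set (EuclideanSpace ℝ (Fin m))) (lam : ℝ)
    (f : EuclideanSpace ℝ (Fin m) → ℝ) (P P' : Finset (EuclideanSpace ℝ (Fin m))) : Prop :=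
  (∃ σ ∈ delaunay P m, (∀ τ ∈ delaunay P m, liftVol lam f τ ≤ liftVol lam f σ) ∧
      ∃ p, IsQuery A σ p ∧ (P' : Set (EuclideanSpace ℝ (Fin m))) = insert p ↑P) ∨
    (delaunay P m = ∅ ∧ P' = P)

end ANNR

/-! Suppose the maximal lifted volume is eventually at least `ε`. By compactness, along a
subsequence the vertices, centroids, queries and supporting normals of the chosen simplices
converge. The Cayley-Menger volume is continuous and vanishes on affinely dependent points, so the
limit lifting is nondegenerate and its projection spans at least a hyperplane
(`nearlySpanning_of_affineIndependent`).

Each query lies outside the open circumscribed balls of later simplices, yet consecutive queries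
become arbitrarily close. By `query_estimates` this forces the circumcenters to infinity and the
queries towards the centroids. Every late query is thus a boundary point, and the limit vertices lie
in the limit supporting hyperplane. The direction to the next circumcenter tends to the same normal.
`not_tendsto_query` then excludes this flat limit by comparing the two directions to first order:
their normalized difference would converge to a unit vector that has to be zero. -/

namespace ANNR

open Filter Topology

/-! ### Geometry of convergent sequences of simplices and queries. -/

section Sequences

variable {E : Type*} [NormedAddCommGroup E] [InnerProductSpace ℝ E]

/-- Parallel axis theorem for finitely many points. -/
theorem sum_norm_sub_sq_of_centroid {ι : Type*} [Fintype ι] {v : ι → E} {b : E}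
    (hb : ∑ i, (v i - b) = 0) (c : E) :
    ∑ i, ‖c - v i‖ ^ 2 = Fintype.card ι * ‖c - b‖ ^ 2 + ∑ i, ‖v i - b‖ ^ 2 := by
  have h : ∀ i, ‖c - v i‖ ^ 2 = ‖c - b‖ ^ 2 - 2 * inner ℝ (c - b) (v i - b) + ‖v i - b‖ ^ 2 := by
    intro i
    rw [← norm_sub_sq_real]
    congr 2
    abel
  simp only [h, Finset.sum_add_distrib, Finset.sum_sub_distrib, ← Finset.mul_sum, ← inner_sum, hb]
  simp

theorem inner_sub_sub_eq_norm (x p c : E) :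
    inner ℝ (x - p) (c - p) = (‖x - p‖ ^ 2 + ‖c - p‖ ^ 2 - ‖c - x‖ ^ 2) / 2 := by
  have h : c - x = (c - p) - (x - p) := by abel
  rw [h, norm_sub_sq_real (c - p) (x - p), real_inner_comm (c - p)]
  ring

/-- If `p` is at least as far from `c` as `x` is, then `x` is on the same side of `p` as `c`. -/
theorem inner_nonneg_of_dist_le {x p c : E} (h : ‖c - x‖ ≤ ‖c - p‖) :
    0 ≤ inner ℝ (x - p) (c - p) := by
  rw [inner_sub_sub_eq_norm]
  have := pow_le_pow_left₀ (norm_nonneg _) h 2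
  nlinarith [sq_nonneg ‖x - p‖]

theorem inner_eq_zero_of_sum_eq_zero {ι : Type*} [Fintype ι] {v : ι → E} {b : E}
    (hb : ∑ i, (v i - b) = 0) {n : E} (h : ∀ i, 0 ≤ inner ℝ (v i - b) n) (i : ι) :
    inner ℝ (v i - b) n = 0 := by
  have : ∑ i, inner ℝ (v i - b) n = 0 := by rw [← sum_inner, hb, inner_zero_left]
  exact (Finset.sum_eq_zero_iff_of_nonneg fun i _ => h i).1 this i (Finset.mem_univ i)

theorem inner_eq_zero_of_sum_eq_zero' {ι : Type*} [Fintype ι] {v : ι → E} {b : E}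
    (hb : ∑ i, (v i - b) = 0) {n : E} (h : ∀ i, inner ℝ (v i - b) n ≤ 0) (i : ι) :
    inner ℝ (v i - b) n = 0 := by
  have := inner_eq_zero_of_sum_eq_zero hb (n := -n) (fun i => by
    rw [inner_neg_right]; linarith [h i]) i
  rw [inner_neg_right] at this
  linarith

/-- The relations between a simplex with vertices `v` and centroid `b`, the center `c` of its
circumscribed ball, a point `p` outside this ball, and a point `b + s • (c - b)` of the segment
between `b` and `c`. -/
theorem query_estimates {ι : Type*} [Fintype ι] [Nonempty ι] {v : ι → E} {b c p : E}
    (hb : ∑ i, (v i - b) = 0) (hc : ∀ i, ‖c - v i‖ ≤ ‖c - p‖) {s : ℝ} (hs0 : 0 ≤ s) (hs1 : s ≤ 1) :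
    ‖c - b‖ ≤ ‖c - p‖ ∧
    s * ‖c - p‖ ≤ ‖b + s • (c - b) - p‖ ∧
    (∑ i, ‖v i - b‖ ^ 2) / (2 * Fintype.card ι) ≤ ‖b + s • (c - b) - p‖ * ‖c - p‖ := by
  set L := ‖c - p‖ with hL
  set N : ℝ := (Fintype.card ι : ℝ) with hN
  set D := ∑ i, ‖v i - b‖ ^ 2 with hD
  have hN0 : 0 < N := by rw [hN]; exact_mod_cast Fintype.card_pos
  have hD0 : 0 ≤ D := Finset.sum_nonneg fun i _ => sq_nonneg _
  have hL0 : 0 ≤ L := norm_nonneg _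
  have h1 : N * ‖c - b‖ ^ 2 + D ≤ N * L ^ 2 := by
    rw [hN, hD, ← sum_norm_sub_sq_of_centroid hb c]
    calc _ ≤ ∑ _i : ι, L ^ 2 :=
          Finset.sum_le_sum fun i _ => pow_le_pow_left₀ (norm_nonneg _) (hc i) 2
      _ = _ := by simp
  have h1' : ‖c - b‖ ^ 2 + D / N ≤ L ^ 2 := by
    have := div_le_div_of_nonneg_right h1 hN0.le
    rwa [add_div, mul_div_cancel_left₀ _ hN0.ne', mul_div_cancel_left₀ _ hN0.ne'] at this
  have hDN : 0 ≤ D / N := div_nonneg hD0 hN0.le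
  -- Polarization: the product is half of `‖b - p‖ ^ 2 + L ^ 2 - ‖c - b‖ ^ 2`, and `h1'` bounds the
  -- last two terms below by `D / N`. Cauchy-Schwarz (`h4`) later turns such bounds into the claims.
  have h2 : D / N / 2 ≤ inner ℝ (b - p) (c - p) := by
    rw [inner_sub_sub_eq_norm]
    nlinarith [sq_nonneg ‖b - p‖]
  have h3 : inner ℝ (b + s • (c - b) - p) (c - p) =
      (1 - s) * inner ℝ (b - p) (c - p) + s * L ^ 2 := by
    have : b + s • (c - b) - p = (1 - s) • (b - p) + s • (c - p) := by module
    rw [this, inner_add_left, real_inner_smul_left, real_inner_smul_left,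
      real_inner_self_eq_norm_sq]
  have h4 := real_inner_le_norm (b + s • (c - b) - p) (c - p)
  have hbc : ‖c - b‖ ≤ L := by
    apply le_of_sq_le_sq _ hL0
    linarith
  refine ⟨hbc, ?_, ?_⟩
  · rcases hL0.eq_or_lt with h | h
    · rw [← h]; simp
    · have : (s * L) * L ≤ ‖b + s • (c - b) - p‖ * L := by
        nlinarith [mul_nonneg (sub_nonneg.2 hs1)
          (hDN.trans (by linarith : D / N ≤ 2 * inner ℝ (b - p) (c - p)))]
      exact le_of_mul_le_mul_right this h
  · have e : D / (2 * N) = D / N / 2 := by rw [mul_comm, div_div]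
    rw [e]
    nlinarith [mul_le_mul_of_nonneg_left h2 (sub_nonneg.2 hs1),
      mul_le_mul_of_nonneg_left h1' hs0, mul_nonneg hs0 (sq_nonneg ‖c - b‖), mul_nonneg hs0 hDN]

/-- An ultrafilter limit replaces a further subsequence, so consecutive indices stay consecutive. -/
theorem exists_tendsto_hyperfilter [FiniteDimensional ℝ E] {u : ℕ → E}
    (hu : ∀ᶠ j in atTop, ‖u j‖ = 1) :
    ∃ a : E, ‖a‖ = 1 ∧ Tendsto u (hyperfilter ℕ : Filter ℕ) (𝓝 a) := by
  have := FiniteDimensional.proper ℝ E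
  have h : ∀ᶠ j in (hyperfilter ℕ : Filter ℕ), u j ∈ Metric.sphere (0 : E) 1 := by
    filter_upwards [Nat.hyperfilter_le_atTop hu] with j hj
    simpa using hj
  obtain ⟨a, ha, hle⟩ := (isCompact_sphere (0 : E) 1).ultrafilter_le_nhds
    ((hyperfilter ℕ).map u) (by rw [Filter.le_principal_iff]; exact h)
  exact ⟨a, by simpa using ha, hle⟩

/-- The points `x` are not all equal, and the orthogonal complement of the directions `x i - b` is
at most one-dimensional. -/
def NearlySpanning {ι : Type*} (x : ι → E) (b : E) : Prop :=
  (∃ i, x i ≠ b) ∧ ∀ n w : E, n ≠ 0 → (∀ i, inner ℝ (x i - b) n = 0) →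
    (∀ i, inner ℝ (x i - b) w = 0) → inner ℝ w n = 0 → w = 0

/-- The geometry of infinitely many queries whose data converge: there is no sequence of simplices
with vertices `v j`, centroid `b j` and circumcenter `c j` such that the query
`p j = b j + s j • (c j - b j)` of each of them is outside the open circumscribed ball of the next
one, if `A` is supported at `p j` by the hyperplane with normal `n j` whenever `c j ∉ A`. -/
theorem not_tendsto_query [FiniteDimensional ℝ E] {ι : Type*} [Fintype ι] [Nonempty ι] {A : Set E}
    (hA : Bornology.IsBounded A) {v : ℕ → ι → E} {b c p n : ℕ → E} {s : ℕ → ℝ}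
    {x : ι → E} {β q ν : E}
    (hvA : ∀ j i, v j i ∈ A) (hpA : ∀ j, p j ∈ A) (hbA : ∀ j, b j ∈ A)
    (hb : ∀ j, ∑ i, (v j i - b j) = 0)
    (hs0 : ∀ j, 0 ≤ s j) (hs1 : ∀ j, s j ≤ 1) (hp : ∀ j, p j = b j + s j • (c j - b j))
    (hc : ∀ j i, ‖c (j + 1) - v (j + 1) i‖ ≤ ‖c (j + 1) - p j‖)
    (hn : ∀ j, c j ∉ A → ‖n j‖ = 1 ∧ ∀ y ∈ A, inner ℝ (y - p j) (n j) ≤ 0)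
    (hv : ∀ j w, (∀ i, inner ℝ (v j i - b j) w = 0) → w = 0)
    (hx : ∀ i, Tendsto (fun j => v j i) atTop (𝓝 (x i))) (hβ : Tendsto b atTop (𝓝 β))
    (hq : Tendsto p atTop (𝓝 q)) (hν : Tendsto n atTop (𝓝 ν))
    (hspan : NearlySpanning x β) : False := by
  have shift {X : Type _} [TopologicalSpace X] {g : ℕ → X} {a : X} (h : Tendsto g atTop (𝓝 a)) :
      Tendsto (fun j => g (j + 1)) atTop (𝓝 a) := h.comp (tendsto_add_atTop_nat 1)
  obtain ⟨⟨i₀, hi₀⟩, hspan⟩ := hspan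
  have hxβ : ∑ i, (x i - β) = 0 := by
    refine tendsto_nhds_unique (tendsto_finsetSum Finset.univ fun i _ => (hx i).sub hβ) ?_
    simp only [hb]
    exact tendsto_const_nhds
  set L : ℕ → ℝ := fun j => ‖c (j + 1) - p j‖ with hL
  set δ : ℕ → ℝ := fun j => ‖p (j + 1) - p j‖ with hδ
  have hδ0 : Tendsto δ atTop (𝓝 0) := by
    have := ((shift hq).sub hq).norm
    simpa using this
  have est := fun j => query_estimates (hb (j + 1)) (hc j) (hs0 (j + 1)) (hs1 (j + 1))
  simp only [← hp] at est
  set D : ℕ → ℝ := fun j => (∑ i, ‖v (j + 1) i - b (j + 1)‖ ^ 2) / (2 * Fintype.card ι) with hD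
  have hDlim : Tendsto D atTop (𝓝 ((∑ i, ‖x i - β‖ ^ 2) / (2 * Fintype.card ι))) :=
    (tendsto_finsetSum Finset.univ fun i _ =>
      ((shift (hx i)).sub (shift hβ)).norm.pow 2).div_const _
  set d : ℝ := (∑ i, ‖x i - β‖ ^ 2) / (2 * Fintype.card ι) with hd
  have hd0 : 0 < d := by
    apply div_pos
    · refine Finset.sum_pos' (fun i _ => sq_nonneg _) ⟨i₀, Finset.mem_univ _, ?_⟩
      have := norm_pos_iff.2 (sub_ne_zero.2 hi₀)
      positivity
    · have : 0 < Fintype.card ι := Fintype.card_pos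
      positivity
  have hDpos : ∀ᶠ j in atTop, 0 < D j := hDlim.eventually (lt_mem_nhds hd0)
  have hLpos : ∀ᶠ j in atTop, 0 < L j := by
    filter_upwards [hDpos] with j hj
    refine (norm_nonneg _).lt_of_ne fun h => ?_
    have := (est j).2.2
    rw [← h, mul_zero] at this
    linarith
  -- The estimate `D j ≤ δ j * L j`, with `δ` tending to `0` and `D` to `d > 0`, makes `L` blow up.
  have hLinv : Tendsto (fun j => (L j)⁻¹) atTop (𝓝 0) := by
    have hu : Tendsto (fun j => δ j / D j) atTop (𝓝 0) := by
      have := hδ0.div hDlim hd0.ne'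
      rwa [zero_div] at this
    refine tendsto_of_tendsto_of_tendsto_of_le_of_le' tendsto_const_nhds hu
      (Eventually.of_forall fun j => inv_nonneg.2 (norm_nonneg _)) ?_
    filter_upwards [hDpos, hLpos] with j hj hj'
    rw [inv_le_iff_one_le_mul₀ hj', div_mul_eq_mul_div, le_div_iff₀ hj, one_mul]
    exact (est j).2.2
  have hcA : ∀ᶠ j in atTop, c (j + 1) ∉ A := by
    obtain ⟨r, hr0, hr⟩ := hA.exists_pos_norm_le
    filter_upwards [hLinv.eventually (gt_mem_nhds (show 0 < (2 * r)⁻¹ by positivity)), hLpos]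
      with j hj hj' hjA
    rw [inv_lt_inv₀ hj' (by positivity)] at hj
    have := norm_sub_le (c (j + 1)) (p j)
    have h1 := hr _ hjA
    have h2 := hr _ (hpA j)
    simp only [hL] at hj
    linarith
  have hcA' : ∀ᶠ j in atTop, c j ∉ A := by
    rw [eventually_atTop] at hcA ⊢
    obtain ⟨a, ha⟩ := hcA
    refine ⟨a + 1, fun j hj => ?_⟩
    obtain ⟨k, rfl⟩ : ∃ k, j = k + 1 := ⟨j - 1, by omega⟩
    exact ha k (by omega)
  have hqβ : q = β := by
    have h1 : Tendsto (fun j => p (j + 1) - b (j + 1)) atTop (𝓝 0) := by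
      apply squeeze_zero_norm (a := δ) _ hδ0
      intro j
      have h2 : p (j + 1) - b (j + 1) = s (j + 1) • (c (j + 1) - b (j + 1)) := by
        rw [hp (j + 1)]; abel
      rw [h2, norm_smul, Real.norm_of_nonneg (hs0 _)]
      exact (mul_le_mul_of_nonneg_left (est j).1 (hs0 _)).trans (est j).2.1
    exact sub_eq_zero.1 (tendsto_nhds_unique ((shift hq).sub (shift hβ)) h1)
  subst hqβ
  have hν1 : ‖ν‖ = 1 := by
    refine tendsto_nhds_unique hν.norm (tendsto_const_nhds.congr' ?_)
    filter_upwards [hcA'] with j hj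
    exact (hn j hj).1.symm
  have hν0 : ν ≠ 0 := by
    rw [← norm_pos_iff, hν1]; exact one_pos
  -- The limit hyperplane supports at the centroid `q` of the `x i`: products of one sign with zero
  -- sum all vanish.
  have hνx : ∀ i, inner ℝ (x i - q) ν = 0 := by
    refine inner_eq_zero_of_sum_eq_zero' hxβ fun i => ?_
    refine le_of_tendsto (((shift (hx i)).sub hq).inner hν) ?_
    filter_upwards [hcA'] with j hj
    exact (hn j hj).2 _ (hvA _ _)
  set u : ℕ → E := fun j => (L j)⁻¹ • (c (j + 1) - p j) with hu
  have hu1 : ∀ᶠ j in atTop, ‖u j‖ = 1 := by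
    filter_upwards [hLpos] with j hj
    rw [hu, norm_smul, norm_inv, Real.norm_of_nonneg hj.le]
    exact inv_mul_cancel₀ hj.ne'
  have huv : ∀ j i, 0 ≤ inner ℝ (v (j + 1) i - p j) (u j) := fun j i => by
    rw [hu, real_inner_smul_right]
    exact mul_nonneg (inv_nonneg.2 (norm_nonneg _)) (inner_nonneg_of_dist_le (hc j i))
  have hU : (hyperfilter ℕ : Filter ℕ) ≤ atTop := Nat.hyperfilter_le_atTop
  obtain ⟨μ, hμ1, hμ⟩ := exists_tendsto_hyperfilter hu1
  have hμx : ∀ i, inner ℝ (x i - q) μ = 0 := by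
    refine inner_eq_zero_of_sum_eq_zero hxβ fun i => ?_
    exact ge_of_tendsto' ((((shift (hx i)).sub hq).mono_left hU).inner hμ) fun j => huv j i
  -- If `s j = 0`, the centroid is on the supporting hyperplane, hence so are all vertices, and the
  -- simplex is degenerate.
  have hspos : ∀ᶠ j in atTop, 0 < s j := by
    filter_upwards [hcA'] with j hj
    refine (hs0 j).lt_of_ne fun h => ?_
    have h1 : p j = b j := by rw [hp j, ← h]; simp
    obtain ⟨h2, h3⟩ := hn j hj
    have h4 := hv j (n j) (inner_eq_zero_of_sum_eq_zero' (hb j) fun i => by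
      rw [← h1]; exact h3 _ (hvA j i))
    simp [h4] at h2
  have hcn : ∀ᶠ j in atTop, 0 ≤ inner ℝ (c j - b j) (n j) := by
    filter_upwards [hcA', hspos] with j hj hsj
    have h1 := (hn j hj).2 _ (hbA j)
    have h2 : b j - p j = -(s j • (c j - b j)) := by rw [hp j]; abel
    rw [h2, inner_neg_left, real_inner_smul_left] at h1
    exact nonneg_of_mul_nonneg_right (by linarith) hsj
  have hμν : 0 ≤ inner ℝ μ ν := by
    -- Replacing `p j` by `b (j + 1)` as base point does not change the limit direction, because `L`
    -- tends to infinity.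
    have h1 : Tendsto (fun j => u j + (L j)⁻¹ • (p j - b (j + 1))) (hyperfilter ℕ : Filter ℕ)
        (𝓝 μ) := by
      have := hμ.add ((hLinv.smul (hq.sub (shift hβ))).mono_left hU)
      simpa using this
    refine ge_of_tendsto (h1.inner ((shift hν).mono_left hU)) (hU ?_)
    filter_upwards [(tendsto_add_atTop_nat 1).eventually hcn] with j hj
    have h2 : u j + (L j)⁻¹ • (p j - b (j + 1)) = (L j)⁻¹ • (c (j + 1) - b (j + 1)) := by
      simp only [hu]; module
    rw [h2, real_inner_smul_left]
    exact mul_nonneg (inv_nonneg.2 (norm_nonneg _)) hj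
  have hμeq : μ = ν := by
    have h1 : μ - (inner ℝ μ ν : ℝ) • ν = 0 := by
      apply hspan ν _ hν0 hνx
      · intro i
        rw [inner_sub_right, real_inner_smul_right, hμx, hνx]; simp
      · rw [inner_sub_left, real_inner_smul_left, real_inner_self_eq_norm_sq, hν1]; simp
    have h2 : μ = (inner ℝ μ ν : ℝ) • ν := sub_eq_zero.1 h1
    have h3 : inner ℝ μ ν = (1 : ℝ) := by
      have := congrArg norm h2
      rw [norm_smul, hμ1, hν1, Real.norm_of_nonneg hμν, mul_one] at this
      exact this.symm
    rw [h2, h3, one_smul]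
  subst hμeq
  -- If `u j = n j`, the inequalities from the ball and from the support of `A` are opposite, so the
  -- next simplex lies in a hyperplane.
  have hne : ∀ᶠ j in atTop, u j - n j ≠ 0 := by
    filter_upwards [hcA'] with j hj h
    rw [sub_eq_zero] at h
    obtain ⟨h2, h3⟩ := hn j hj
    have h4 : ∀ i, inner ℝ (v (j + 1) i - p j) (n j) = 0 := fun i =>
      le_antisymm (h3 _ (hvA _ _)) (h ▸ huv j i)
    have h5 : inner ℝ (b (j + 1) - p j) (n j) = 0 := by
      have h6 : inner ℝ (∑ i, (v (j + 1) i - b (j + 1))) (n j) =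
          -(Fintype.card ι * inner ℝ (b (j + 1) - p j) (n j)) := by
        have h7 : ∀ i, inner ℝ (v (j + 1) i - b (j + 1)) (n j) =
            -inner ℝ (b (j + 1) - p j) (n j) := fun i => by
          rw [← sub_sub_sub_cancel_right _ _ (p j), inner_sub_left, h4]; simp
        rw [sum_inner, Finset.sum_congr rfl fun i _ => h7 i]; simp
      rw [hb, inner_zero_left] at h6
      have h8 : (Fintype.card ι : ℝ) ≠ 0 := by exact_mod_cast Fintype.card_ne_zero
      simpa [h8] using h6.symm
    have h9 := hv (j + 1) (n j) fun i => by
      rw [← sub_sub_sub_cancel_right _ _ (p j), inner_sub_left, h4, h5, sub_zero]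
    simp [h9] at h2
  obtain ⟨w, hw1, hw⟩ := exists_tendsto_hyperfilter (u := fun j => ‖u j - n j‖⁻¹ • (u j - n j)) (by
    filter_upwards [hne] with j hj
    rw [norm_smul, norm_inv, norm_norm]
    exact inv_mul_cancel₀ (norm_ne_zero_iff.2 hj))
  have hw0 : w = 0 := by
    apply hspan μ _ hν0 hνx
    · refine inner_eq_zero_of_sum_eq_zero hxβ fun i => ?_
      refine ge_of_tendsto ((((shift (hx i)).sub hq).mono_left hU).inner hw) (hU ?_)
      filter_upwards [hcA'] with j hj
      rw [real_inner_smul_right, inner_sub_right]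
      have h1 := (hn j hj).2 _ (hvA (j + 1) i)
      exact mul_nonneg (inv_nonneg.2 (norm_nonneg _)) (by linarith [huv j i])
    -- Sum and difference of the unit vectors `u j` and `n j` are orthogonal, and the sum tends to
    -- `μ + μ`.
    · have h1 : inner ℝ w (μ + μ) = (0 : ℝ) := by
        refine tendsto_nhds_unique (hw.inner (hμ.add (hν.mono_left hU)))
          (tendsto_const_nhds.congr' (hU ?_))
        filter_upwards [hcA', hu1] with j hj hj'
        have h2 := (hn j hj).1
        rw [real_inner_smul_left, real_inner_comm, real_inner_add_sub_eq_zero_iff _ _ |>.2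
          (hj'.trans h2.symm), mul_zero]
      rw [inner_add_right] at h1
      linarith
  simp [hw0] at hw1

end Sequences

/-! ### Cayley-Menger volumes and liftings. -/

section Volume

theorem simplexVol_nonneg {X : Type*} [MetricSpace X] {k : ℕ} (v : Fin (k + 1) → X) :
    0 ≤ simplexVol v :=
  Real.sqrt_nonneg _

theorem continuous_simplexVol {X : Type*} [MetricSpace X] {k : ℕ} :
    Continuous (simplexVol : (Fin (k + 1) → X) → ℝ) := by
  unfold simplexVol
  refine Real.continuous_sqrt.comp (continuous_const.mul (Continuous.matrix_det ?_))
  refine continuous_matrix fun i j => ?_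
  rcases i with i | i <;> rcases j with j | j <;>
    simp only [cayleyMengerMatrix, Matrix.fromBlocks_apply₁₁, Matrix.fromBlocks_apply₁₂,
      Matrix.fromBlocks_apply₂₁, Matrix.fromBlocks_apply₂₂, Matrix.of_apply] <;>
    fun_prop

/-- The Cayley-Menger volume of affinely dependent points vanishes. -/
theorem affineIndependent_of_simplexVol_ne_zero {E : Type*} [NormedAddCommGroup E]
    [InnerProductSpace ℝ E] {k : ℕ} {v : Fin (k + 1) → E} (h : simplexVol v ≠ 0) :
    AffineIndependent ℝ v := by
  by_contra hv
  apply h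
  rw [affineIndependent_iff_of_fintype] at hv
  push Not at hv
  obtain ⟨g, hg0, hgv, i₀, hi₀⟩ := hv
  rw [Finset.weightedVSub_eq_weightedVSubOfPoint_of_sum_eq_zero _ _ _ hg0 0,
    Finset.weightedVSubOfPoint_apply] at hgv
  simp only [vsub_eq_sub, sub_zero] at hgv
  have hdet : (cayleyMengerMatrix v).det = 0 := by
    rw [← Matrix.exists_mulVec_eq_zero_iff]
    -- The affine dependency `g` extends to a kernel vector: the extra entry cancels the terms `g j
    -- * ‖v j‖ ^ 2`.
    refine ⟨Sum.elim (fun _ => -∑ j, g j * ‖v j‖ ^ 2) g, fun hz => hi₀ (congrFun hz (Sum.inr i₀)),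
      ?_⟩
    funext i
    rcases i with i | i
    · simp [cayleyMengerMatrix, Matrix.mulVec, dotProduct, hg0]
    · have h1 : ∀ j, dist (v i) (v j) ^ 2 * g j =
          ‖v i‖ ^ 2 * g j - 2 * inner ℝ (v i) (g j • v j) + g j * ‖v j‖ ^ 2 := fun j => by
        rw [dist_eq_norm, norm_sub_sq_real, real_inner_smul_right]; ring
      simp [cayleyMengerMatrix, Matrix.mulVec, dotProduct, h1, Finset.sum_add_distrib,
        ← Finset.mul_sum, ← inner_sum, hgv, hg0]
  simp [simplexVol, hdet]

variable {m : ℕ}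

theorem inner_graphPoint (a b : ℝ) (f g : EuclideanSpace ℝ (Fin m) → ℝ)
    (x y : EuclideanSpace ℝ (Fin m)) :
    inner ℝ (graphPoint a f x) (graphPoint b g y) = inner ℝ x y + (a * f x) * (b * g y) := by
  simp [graphPoint, PiLp.inner_apply, Fin.sum_univ_castSucc]
  ring

theorem continuousOn_graphPoint {A : Set (EuclideanSpace ℝ (Fin m))} (lam : ℝ)
    {f : EuclideanSpace ℝ (Fin m) → ℝ} (hf : ContinuousOn f A) :
    ContinuousOn (graphPoint lam f) A := by
  unfold graphPoint
  refine (PiLp.continuous_toLp 2 _).comp_continuousOn (continuousOn_pi.2 fun i => ?_)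
  refine Fin.lastCases ?_ (fun i => ?_) i
  · simp only [Fin.snoc_last]
    exact continuousOn_const.mul hf
  · simp only [Fin.snoc_castSucc]
    fun_prop

/-- If the liftings of `m + 1` points are affinely independent, then the points span at least a
hyperplane. -/
theorem nearlySpanning_of_affineIndependent (hm : 1 ≤ m) {lam : ℝ}
    {f : EuclideanSpace ℝ (Fin m) → ℝ} {x : Fin (m + 1) → EuclideanSpace ℝ (Fin m)}
    (h : AffineIndependent ℝ fun i => graphPoint lam f (x i)) (β : EuclideanSpace ℝ (Fin m)) :
    NearlySpanning x β := by
  constructor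
  · by_contra! hall
    have h01 : (0 : Fin (m + 1)) = Fin.last m := h.injective (by simp [hall])
    have := congrArg Fin.val h01
    simp at this
    omega
  · intro n w hn hxn hxw hwn
    by_contra hw
    -- With `lam = 0` these are `(n, 0)` and `(w, 0)`. Both are orthogonal to the `m`-dimensional
    -- direction of the lifting, too many for `ℝᵐ⁺¹`.
    set N := graphPoint 0 f n
    set W := graphPoint 0 f w
    have hNW : inner ℝ N W = (0 : ℝ) := by
      rw [inner_graphPoint, real_inner_comm, hwn]; simp
    have hN : N ≠ 0 := by
      rw [← inner_self_ne_zero (𝕜 := ℝ), inner_graphPoint]; simpa using hn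
    have hW : W ≠ 0 := by
      rw [← inner_self_ne_zero (𝕜 := ℝ), inner_graphPoint]; simpa using hw
    have hli : LinearIndependent ℝ ![N, W] := by
      refine linearIndependent_of_ne_zero_of_inner_eq_zero (𝕜 := ℝ) ?_ ?_
      · intro i; fin_cases i <;> simpa
      · intro i j hij
        fin_cases i <;> fin_cases j <;> first | exact absurd rfl hij | skip
        · simpa using hNW
        · simpa [real_inner_comm] using hNW
    have h2 := finrank_span_eq_card hli
    set K := Submodule.span ℝ (Set.range ![N, W])
    have horth : ∀ y, (∀ i, inner ℝ (x i - β) y = 0) → ∀ i j,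
        inner ℝ (graphPoint 0 f y) (graphPoint lam f (x i) - graphPoint lam f (x j)) = (0 : ℝ) := by
      intro y hy i j
      have hi := hy i
      have hj := hy j
      rw [inner_sub_left] at hi hj
      rw [inner_sub_right, inner_graphPoint, inner_graphPoint, real_inner_comm,
        real_inner_comm (x j)]
      linarith
    have hle : vectorSpan ℝ (Set.range fun i => graphPoint lam f (x i)) ≤ Kᗮ := by
      rw [vectorSpan_def, Submodule.span_le]
      rintro _ ⟨_, ⟨i, rfl⟩, _, ⟨j, rfl⟩, rfl⟩
      rw [SetLike.mem_coe, Submodule.mem_orthogonal]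
      intro y hy
      induction hy using Submodule.span_induction with
      | mem y hy =>
        obtain ⟨l, rfl⟩ := hy
        fin_cases l
        · exact horth n hxn i j
        · exact horth w hxw i j
      | zero => simp
      | add a b _ _ ha hb => rw [inner_add_left, ha, hb, add_zero]
      | smul r a _ ha => rw [real_inner_smul_left, ha, mul_zero]
    have h3 := Submodule.finrank_mono hle
    rw [h.finrank_vectorSpan (n := m) (by simp)] at h3
    have h4 := Submodule.finrank_add_finrank_orthogonal K
    simp at h2 h4
    omega

end Volume

/-! ### Full-dimensional Delaunay simplices and supporting hyperplanes. -/

section Simplices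

variable {m : ℕ}

theorem affineSpan_points_eq_top (σ : Affine.Simplex ℝ (EuclideanSpace ℝ (Fin m)) m) :
    affineSpan ℝ (Set.range σ.points) = ⊤ := by
  rw [σ.independent.affineSpan_eq_top_iff_card_eq_finrank_add_one]
  simp

theorem eq_zero_of_inner_points_sub_centroid
    (σ : Affine.Simplex ℝ (EuclideanSpace ℝ (Fin m)) m) {w : EuclideanSpace ℝ (Fin m)}
    (h : ∀ i, inner ℝ (σ.points i - σ.centroid) w = 0) : w = 0 := by
  have hs : vectorSpan ℝ (Set.range σ.points) = ⊤ :=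
    AffineSubspace.vectorSpan_eq_top_of_affineSpan_eq_top _ _ _ (affineSpan_points_eq_top σ)
  have hle : vectorSpan ℝ (Set.range σ.points) ≤ (Submodule.span ℝ {w})ᗮ := by
    rw [vectorSpan_def, Submodule.span_le]
    rintro _ ⟨_, ⟨i, rfl⟩, _, ⟨j, rfl⟩, rfl⟩
    change σ.points i - σ.points j ∈ _
    rw [SetLike.mem_coe, Submodule.mem_orthogonal_singleton_iff_inner_left,
      ← sub_sub_sub_cancel_right _ _ σ.centroid, inner_sub_left, h, h, sub_zero]
  rw [hs, top_le_iff] at hle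
  have : w ∈ (Submodule.span ℝ {w})ᗮ := hle ▸ Submodule.mem_top
  rw [Submodule.mem_orthogonal_singleton_iff_inner_left] at this
  exact inner_self_eq_zero.1 this

/-- The open circumscribed ball of a Delaunay simplex contains no datapoint. -/
theorem dist_circumcenter_le_of_mem_delaunay {P : Finset (EuclideanSpace ℝ (Fin m))}
    {σ : Affine.Simplex ℝ (EuclideanSpace ℝ (Fin m)) m} (hσ : σ ∈ delaunay P m) (i : Fin (m + 1))
    {q : EuclideanSpace ℝ (Fin m)} (hq : q ∈ P) :
    dist σ.circumcenter (σ.points i) ≤ dist σ.circumcenter q := by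
  obtain ⟨hP, y, hy⟩ := hσ
  rw [Set.mem_iInter] at hy
  -- A common point of the cells is equidistant from all vertices.
  have hyc : y = σ.circumcenter := by
    refine σ.eq_circumcenter_of_dist_eq (by rw [affineSpan_points_eq_top]; trivial)
      (r := dist y (σ.points 0)) fun i => ?_
    rw [dist_comm]
    exact le_antisymm (hy i _ (hP 0)) (hy 0 _ (hP i))
  rw [← hyc]
  exact hy i q hq

theorem centroid_mem_of_convex {A : Set (EuclideanSpace ℝ (Fin m))} (hA : Convex ℝ A)
    {σ : Affine.Simplex ℝ (EuclideanSpace ℝ (Fin m)) m} (hσ : ∀ i, σ.points i ∈ A) :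
    σ.centroid ∈ A :=
  convexHull_min (Set.range_subset_iff.2 hσ) hA
    (affineCombination_mem_convexHull
      (fun i _ => by simp only [Finset.centroidWeights_apply]; positivity)
      (Finset.sum_centroidWeights_eq_one_of_nonempty ℝ _ Finset.univ_nonempty))

/-- A convex set which contains the vertices of an `m`-simplex has a supporting hyperplane at each
of its boundary points. -/
theorem exists_unit_normal {A : Set (EuclideanSpace ℝ (Fin m))} (hA : Convex ℝ A)
    {σ : Affine.Simplex ℝ (EuclideanSpace ℝ (Fin m)) m} (hσ : ∀ i, σ.points i ∈ A)
    {p : EuclideanSpace ℝ (Fin m)} (hp : p ∈ frontier A) :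
    ∃ n : EuclideanSpace ℝ (Fin m), ‖n‖ = 1 ∧ ∀ y ∈ A, inner ℝ (y - p) n ≤ 0 := by
  have hint : (interior A).Nonempty := by
    have := interior_convexHull_nonempty_iff_affineSpan_eq_top.2 (affineSpan_points_eq_top σ)
    exact this.mono (interior_mono (convexHull_min (Set.range_subset_iff.2 hσ) hA))
  obtain ⟨g, hg0, hg⟩ := geometric_hahn_banach_of_nonempty_interior_point hA hp.2 hint
  set w := (InnerProductSpace.toDual ℝ _).symm g with hw
  have hgw : ∀ y, g y = inner ℝ y w := fun y => by
    rw [real_inner_comm, hw, InnerProductSpace.toDual_symm_apply]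
  have hw0 : w ≠ 0 := by simpa [hw] using hg0
  refine ⟨‖w‖⁻¹ • w, ?_, fun y hy => ?_⟩
  · rw [norm_smul, norm_inv, norm_norm]
    exact inv_mul_cancel₀ (norm_ne_zero_iff.2 hw0)
  · rw [real_inner_smul_right, inner_sub_left, ← hgw, ← hgw]
    exact mul_nonpos_of_nonneg_of_nonpos (inv_nonneg.2 (norm_nonneg _)) (by linarith [hg y hy])

end Simplices

/-! ### The iteration and the compactness argument. -/

variable {m : ℕ} {A : Set (EuclideanSpace ℝ (Fin m))} {lam : ℝ}
  {f : EuclideanSpace ℝ (Fin m) → ℝ}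

theorem maxLiftVol_nonneg (P : Finset (EuclideanSpace ℝ (Fin m))) : 0 ≤ maxLiftVol lam f P := by
  apply Real.sSup_nonneg
  rintro _ ⟨σ, -, rfl⟩
  exact simplexVol_nonneg _

theorem IsQuery.mem (hA : IsClosed A) {σ : Affine.Simplex ℝ (EuclideanSpace ℝ (Fin m)) m}
    {p : EuclideanSpace ℝ (Fin m)} (h : IsQuery A σ p) : p ∈ A := by
  rcases h with ⟨h, rfl⟩ | ⟨-, h, -⟩
  · exact h
  · exact hA.frontier_subset h

theorem IsQuery.mem_segment {σ : Affine.Simplex ℝ (EuclideanSpace ℝ (Fin m)) m}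
    {p : EuclideanSpace ℝ (Fin m)} (h : IsQuery A σ p) :
    p ∈ segment ℝ σ.centroid σ.circumcenter := by
  rcases h with ⟨-, rfl⟩ | ⟨-, -, h⟩
  · exact right_mem_segment ℝ _ _
  · exact h

/-- The dummy normal `0` serves when the circumcenter is in `A`, so that all normals lie in the
compact unit ball. -/
theorem IsQuery.exists_normal (hA : Convex ℝ A)
    {σ : Affine.Simplex ℝ (EuclideanSpace ℝ (Fin m)) m} (hσ : ∀ i, σ.points i ∈ A)
    {p : EuclideanSpace ℝ (Fin m)} (h : IsQuery A σ p) :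
    ∃ n : EuclideanSpace ℝ (Fin m), ‖n‖ ≤ 1 ∧
      (σ.circumcenter ∉ A → ‖n‖ = 1 ∧ ∀ y ∈ A, inner ℝ (y - p) n ≤ 0) := by
  rcases h with ⟨h, -⟩ | ⟨-, h, -⟩
  · exact ⟨0, by simp, fun h' => absurd h h'⟩
  · obtain ⟨n, h1, h2⟩ := exists_unit_normal hA hσ h
    exact ⟨n, h1.le, fun _ => ⟨h1, h2⟩⟩

theorem Step.subset {P P' : Finset (EuclideanSpace ℝ (Fin m))} (h : Step A lam f P P') :
    P ⊆ P' := by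
  rcases h with ⟨σ, -, -, p, -, h⟩ | ⟨-, rfl⟩
  · rw [← Finset.coe_subset, h]
    exact Set.subset_insert _ _
  · exact subset_rfl

theorem Step.subset_of_subset (hA : IsClosed A) {P P' : Finset (EuclideanSpace ℝ (Fin m))}
    (h : Step A lam f P P') (hP : (P : Set (EuclideanSpace ℝ (Fin m))) ⊆ A) :
    (P' : Set (EuclideanSpace ℝ (Fin m))) ⊆ A := by
  rcases h with ⟨σ, -, -, p, hp, h⟩ | ⟨-, rfl⟩
  · rw [h]
    exact Set.insert_subset (hp.mem hA) hP
  · exact hP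

theorem Step.exists_query {P P' : Finset (EuclideanSpace ℝ (Fin m))} (h : Step A lam f P P')
    (hpos : 0 < maxLiftVol lam f P) :
    ∃ σ ∈ delaunay P m, liftVol lam f σ = maxLiftVol lam f P ∧ ∃ p ∈ P', IsQuery A σ p := by
  rcases h with ⟨σ, hσ, hmax, p, hp, h⟩ | ⟨h, -⟩
  · refine ⟨σ, hσ, ?_, p, ?_, hp⟩
    · have : IsGreatest (liftVol lam f '' delaunay P m) (liftVol lam f σ) :=
        ⟨⟨σ, hσ, rfl⟩, by rintro _ ⟨τ, hτ, rfl⟩; exact hmax τ hτ⟩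
      exact this.csSup_eq.symm
    · rw [← Finset.mem_coe, h]
      exact Set.mem_insert _ _
  -- Here `sSup ∅ = 0` contradicts positivity.
  · simp [maxLiftVol, h] at hpos

/-- The lifted volumes fall below each positive bound again and again. -/
theorem exists_maxLiftVol_lt (hm : 1 ≤ m) (hAconv : Convex ℝ A) (hAcomp : IsCompact A)
    (hf : ContinuousOn f A) {P : ℕ → Finset (EuclideanSpace ℝ (Fin m))}
    (hP₀ : (P 0 : Set (EuclideanSpace ℝ (Fin m))) ⊆ A)
    (hstep : ∀ t, Step A lam f (P t) (P (t + 1))) {ε : ℝ} (hε : 0 < ε) (T : ℕ) :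
    ∃ t, T ≤ t ∧ maxLiftVol lam f (P t) < ε := by
  by_contra! hbig
  have hPA : ∀ t, (P t : Set (EuclideanSpace ℝ (Fin m))) ⊆ A := fun t => by
    induction t with
    | zero => exact hP₀
    | succ t ih => exact (hstep t).subset_of_subset hAcomp.isClosed ih
  have hmono : Monotone P := monotone_nat_of_le_succ fun t => (hstep t).subset
  choose σ hσ hvol p hpP hq using fun j : ℕ => (hstep (T + j)).exists_query
    (hε.trans_le (hbig (T + j) (Nat.le_add_right _ _)))
  have hσA : ∀ j i, (σ j).points i ∈ A := fun j i => hPA _ ((hσ j).1 i)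
  choose n hn1 hn using fun j => (hq j).exists_normal hAconv (hσA j)
  have hseg : ∀ j, ∃ s : ℝ, (0 ≤ s ∧ s ≤ 1) ∧
      p j = (σ j).centroid + s • ((σ j).circumcenter - (σ j).centroid) := fun j => by
    have := (hq j).mem_segment
    rw [segment_eq_image'] at this
    obtain ⟨s, hs, h⟩ := this
    exact ⟨s, hs, h.symm⟩
  choose s hs hps using hseg
  have hpA : ∀ j, p j ∈ A := fun j => (hq j).mem hAcomp.isClosed
  have hbA : ∀ j, (σ j).centroid ∈ A := fun j => centroid_mem_of_convex hAconv (hσA j)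
  have hcomp := (isCompact_univ_pi fun _ : Fin (m + 1) => hAcomp).prod
    (hAcomp.prod (hAcomp.prod (isCompact_closedBall (0 : EuclideanSpace ℝ (Fin m)) 1)))
  obtain ⟨⟨x, β, q, ν⟩, hlim, φ, hφ, hφlim⟩ := hcomp.tendsto_subseq
    (x := fun j => ((σ j).points, (σ j).centroid, p j, n j))
    (fun j => ⟨fun i _ => hσA j i, hbA j, hpA j, by simpa using hn1 j⟩)
  rw [Prod.tendsto_iff, Prod.tendsto_iff, Prod.tendsto_iff, tendsto_pi_nhds] at hφlim
  obtain ⟨hx, hβ, hp, hν⟩ := hφlim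
  have hxA : ∀ i, x i ∈ A := fun i => hlim.1 i trivial
  have hvolx : ε ≤ simplexVol fun i => graphPoint lam f (x i) := by
    have hg : Tendsto (fun j i => graphPoint lam f ((σ (φ j)).points i)) atTop
        (𝓝 fun i => graphPoint lam f (x i)) := by
      rw [tendsto_pi_nhds]
      intro i
      have h1 := (continuousOn_graphPoint lam hf) (x i) (hxA i)
      exact h1.tendsto.comp (tendsto_nhdsWithin_iff.2
        ⟨hx i, Eventually.of_forall fun j => hσA _ i⟩)
    refine ge_of_tendsto' ((continuous_simplexVol.tendsto _).comp hg) fun j => ?_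
    have := hbig (T + φ j) (Nat.le_add_right _ _)
    rw [← hvol] at this
    exact this
  refine not_tendsto_query hAcomp.isBounded
    (v := fun j => (σ (φ j)).points) (b := fun j => (σ (φ j)).centroid)
    (c := fun j => (σ (φ j)).circumcenter) (p := fun j => p (φ j)) (n := fun j => n (φ j))
    (s := fun j => s (φ j)) (fun j i => hσA _ i) (fun j => hpA _) (fun j => hbA _)
    (fun j => (σ (φ j)).centroid_weighted_vsub_eq_zero) (fun j => (hs _).1) (fun j => (hs _).2)
    (fun j => hps _) ?_ (fun j => hn _) (fun j w => eq_zero_of_inner_points_sub_centroid _)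
    hx hβ hp hν (nearlySpanning_of_affineIndependent hm
      (affineIndependent_of_simplexVol_ne_zero (hε.trans_le hvolx).ne') β)
  intro j i
  rw [← dist_eq_norm, ← dist_eq_norm]
  -- The query made at time `T + φ j` is a datapoint from `T + φ j + 1` on, which is at most `T + φ
  -- (j + 1)`.
  refine dist_circumcenter_le_of_mem_delaunay (hσ _) i (hmono ?_ (hpP (φ j)))
  have := hφ (Nat.lt_succ_self j)
  simp only [Nat.succ_eq_add_one] at this
  omega

end ANNR

theorem proposition2 {m : ℕ} (hm : 1 ≤ m) (A : Set (EuclideanSpace ℝ (Fin m)))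
    (hAconv : Convex ℝ A) (hAcomp : IsCompact A)
    (f : EuclideanSpace ℝ (Fin m) → ℝ) (K : NNReal) (hf : LipschitzOnWith K f A)
    (lam : ℝ) (hlam : 0 ≤ lam)
    (P : ℕ → Finset (EuclideanSpace ℝ (Fin m))) (hP₀ : (P 0 : Set (EuclideanSpace ℝ (Fin m))) ⊆ A)
    (hstep : ∀ t, ANNR.Step A lam f (P t) (P (t + 1))) :
    Filter.liminf (fun t => ((ANNR.maxLiftVol lam f (P t) : ℝ) : EReal)) Filter.atTop = 0 ∧
      ∀ ε : ℝ, 0 < ε → ∃ t, ANNR.maxLiftVol lam f (P t) < ε := by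
  have key : ∀ ε : ℝ, 0 < ε → ∀ T, ∃ t, T ≤ t ∧ ANNR.maxLiftVol lam f (P t) < ε :=
    fun ε hε T => ANNR.exists_maxLiftVol_lt hm hAconv hAcomp hf.continuousOn hP₀ hstep hε T
  refine ⟨le_antisymm ?_ ?_, fun ε hε => (key ε hε 0).imp fun t ht => ht.2⟩
  · refine EReal.le_of_forall_lt_iff_le.1 fun ε hε => ?_
    refine Filter.liminf_le_of_frequently_le' (Filter.frequently_atTop.2 fun T => ?_)
    obtain ⟨t, ht, hlt⟩ := key ε (by exact_mod_cast hε) T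
    exact ⟨t, ht, by exact_mod_cast hlt.le⟩
  · refine Filter.le_liminf_of_le (by isBoundedDefault) (Filter.Eventually.of_forall fun t => ?_)
    exact_mod_cast ANNR.maxLiftVol_nonneg (P t)
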